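/- Let $G$ be a finite acyclic directed graph (parallel edges allowed) with two distinct sources $S_1,S_2$ and two distinct sinks $R_1,R_2$. A set of Menger's paths from $S_i$ to $R_i$ is a set consisting of the maximum number of pairwise edge-disjoint directed paths from $S_i$ to $R_i$; by Menger's theorem this number is the (edge) min-cut between $S_i$ and $R_i$. Two paths are said to merge at an edge $e$ if both contain $e$ and the edges immediately preceding $e$ on the two paths exist and are distinct. For a set $\phi$ of Menger's paths from $S_1$ to $R_1$ and a set $\psi$ of Menger's paths from $S_2$ to $R_2$, let $|G|_{\mathcal{M}}(\phi,\psi)$ be the number of edges at which some path of $\phi$ merges with some path of $\psi$, and let $M(G)$ be the minimum of $|G|_{\mathcal{M}}(\phi,\psi)$ over all choices of $\phi$ and $\psi$. Let $\mathcal{M}(c_1,c_2)$ be the supremum of $M(G)$ over all such $G$ in which the min-cut between $S_i$ and $R_i$ equals $c_i$ for $i=1,2$. **Theorem.** $\mathcal{M}(3,3)=13$. -/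

import Mathlib

/-- A finite acyclic directed graph (parallel edges allowed) with two distinct sources `S₁`, `S₂`
and two distinct sinks `R₁`, `R₂`. Acyclicity: there is no nonempty closed chain of edges. -/
structure AcyclicNetwork where
  V : Type
  E : Type
  finiteV : Finite V
  finiteE : Finite E
  src : E → V
  tgt : E → V
  acyclic : ∀ p : List E, p.IsChain (fun e f => tgt e = src f) →
    ∀ e ∈ p.head?, ∀ f ∈ p.getLast?, tgt f ≠ src e
  S₁ : V
  S₂ : V
  R₁ : V
  R₂ : V
  sources_ne : S₁ ≠ S₂
  sinks_ne : R₁ ≠ R₂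

namespace AcyclicNetwork

variable (G : AcyclicNetwork)

/-- `p` is a (nonempty) directed path from `u` to `v`, given as the list of its edges.
As `G` is acyclic, no vertex is repeated. -/
def IsPath (u v : G.V) (p : List G.E) : Prop :=
  p.IsChain (fun e f => G.tgt e = G.src f) ∧
    (∃ e ∈ p.head?, G.src e = u) ∧ (∃ e ∈ p.getLast?, G.tgt e = v)

/-- `C` is an edge cut between `u` and `v`: every path from `u` to `v` uses an edge of `C`. -/
def IsCut (u v : G.V) (C : Finset G.E) : Prop :=
  ∀ p : List G.E, G.IsPath u v p → ∃ e ∈ p, e ∈ C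

/-- The set of all edges is a cut. -/
theorem exists_isCut (u v : G.V) : ∃ C : Finset G.E, G.IsCut u v C := by
  have := G.finiteE
  have := Fintype.ofFinite G.E
  refine ⟨Finset.univ, fun p hp => ?_⟩
  obtain ⟨-, ⟨e, he, -⟩, -⟩ := hp
  exact ⟨e, List.mem_of_head? he, Finset.mem_univ e⟩

/-- The min-cut between `u` and `v`: the least number of edges of a cut
(a minimum over a nonempty set, by `exists_isCut`). -/
noncomputable def minCut (u v : G.V) : ℕ :=
  sInf {k : ℕ | ∃ C : Finset G.E, G.IsCut u v C ∧ C.card = k}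

/-- A family of `k` pairwise edge-disjoint directed paths from `u` to `v`. -/
def IsDisjointPaths (u v : G.V) {k : ℕ} (α : Fin k → List G.E) : Prop :=
  (∀ i, G.IsPath u v (α i)) ∧ Pairwise (fun i j => (α i).Disjoint (α j))

/-- Menger's paths from `u` to `v`: a family of pairwise edge-disjoint paths from `u` to `v`
consisting of the maximum number of such paths. -/
def IsMengerPaths (u v : G.V) {k : ℕ} (α : Fin k → List G.E) : Prop :=
  G.IsDisjointPaths u v α ∧
    ∀ (l : ℕ) (β : Fin l → List G.E), G.IsDisjointPaths u v β → l ≤ k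

variable {G}

/-- The paths `β₁` and `β₂` merge at the edge `e`: both contain `e`, and the edges immediately
ahead of `e` on `β₁` and on `β₂` exist and are distinct. -/
def MergeAt (β₁ β₂ : List G.E) (e : G.E) : Prop :=
  ∃ f g : G.E, f ≠ g ∧ [f, e] <:+: β₁ ∧ [g, e] <:+: β₂

/-- The number of mergings between the `φ`-paths and the `ψ`-paths, where all the mergings at the
same edge count as one. (Paths within a family are edge-disjoint, so that only one path of each
family can take part in the mergings at a given edge.) -/
noncomputable def mergings {m n : ℕ} (φ : Fin m → List G.E) (ψ : Fin n → List G.E) : ℕ∞ :=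
  {e : G.E | ∃ i j, MergeAt (φ i) (ψ j) e}.encard

variable (G)

/-- `M(G)`: the minimum number of mergings over all choices of Menger's paths `φ` from `S₁` to
`R₁` and `ψ` from `S₂` to `R₂`. -/
noncomputable def minMergings : ℕ∞ :=
  ⨅ (m : ℕ) (n : ℕ) (φ : Fin m → List G.E) (ψ : Fin n → List G.E)
    (_ : G.IsMengerPaths G.S₁ G.R₁ φ) (_ : G.IsMengerPaths G.S₂ G.R₂ ψ), mergings φ ψ

end AcyclicNetwork

/-- `ℳ(c₁, c₂)`: the supremum of `M(G)` over all acyclic networks `G` with distinct sources and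
distinct sinks in which the min-cut between `Sᵢ` and `Rᵢ` is `cᵢ`, for `i = 1, 2`. -/
noncomputable def maxMinMergings (c₁ c₂ : ℕ) : ℕ∞ :=
  ⨆ (G : AcyclicNetwork) (_ : G.minCut G.S₁ G.R₁ = c₁) (_ : G.minCut G.S₂ G.R₂ = c₂),
    G.minMergings

/-!
Upper bound. Replace a family of edge-disjoint paths by its *linkage*: the set of its edges together
with the relation "`f` follows `e` on a path". Among all pairs of linkages `A`, `B` for the two
source-sink pairs having the right numbers of paths, take one whose union has as few consecutive
pairs as possible. If the residual relation of `A` relative to `B` (walk forward along `B`, backward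
along `A`) had a cycle, `A` could be rerouted along it inside the union, losing a consecutive pair
(`exists_arcs_ssubset_of_not_wellFounded`). So both residual relations are well-founded, and each of
them provides a potential (`exists_isPotential`): for `A` it is weakly increasing along `A`,
weakly decreasing along `B` off `A`, and where `A` enters `y` from `z` and `B` enters `y` from
`x ≠ z`, it is smaller at `z` than at `x`. No form of Menger's theorem is needed, since a maximum
family has at most as many paths as a cut has edges.

Now sweep the edges in a topological order, remembering the last edge seen on each of the at most
three paths of either family, and a `3 × 3` Boolean matrix for each potential of inequalities known
to hold between these edges. A new shared segment on path `i` of `A` and path `j` of `B` is possible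
only if the entries `(i, j)` of the first and `(j, i)` of the second matrix are unset, and it changes
the matrices by a fixed rule, `updateReach`. Starting from empty matrices this finite machine cannot
make fourteen steps (`not_hasRun_fourteen`, an exhaustive search evaluated in the kernel up to
relabelling of paths), and every merging begins a new shared segment (`exists_reached_sweep`).

Lower bound. A run of thirteen steps of the machine yields a network with thirteen shared
edges. A vertex potential that increases exactly along the edges of the first family shows, by
comparing sums over edges, that any three edge-disjoint paths use exactly these edges
(`mem_iff_of_potential`); likewise for the second family. Hence all choices of Menger's paths merge at
the same thirteen edges.
-/

/-! ### The reachability machine -/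

/-- The effect on the matrix `R` of a new shared segment `y` on path `i` of the first and path `j` of
the second family. An entry `R a b` says that the last segment of the first family's path `a` reaches
the last segment of the second family's path `b` in the residual relation. The segment `y` makes the
old last segment of path `j` reach that of path `i`, and takes the place of both: nothing but `y`
itself reaches `y`, and `y` reaches whatever the old last segment of path `i` does. -/
def updateReach (R : Fin 3 → Fin 3 → Bool) (i j a b : Fin 3) : Bool :=
  if b = j then decide (a = i) else R a b || (R a j && R i b)

/-- The machine can make `n` steps from the pair of matrices `R`, `T`. The rows of `R` stand for the
paths of the first family and its columns for those of the second; for `T` it is the other way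
round. -/
def HasRun : ℕ → (Fin 3 → Fin 3 → Bool) → (Fin 3 → Fin 3 → Bool) → Prop
  | 0, _, _ => True
  | n + 1, R, T => ∃ i j, R i j = false ∧ T j i = false ∧
      HasRun n (updateReach R i j) (updateReach T j i)

theorem HasRun.of_succ {n : ℕ} {R T : Fin 3 → Fin 3 → Bool} (h : HasRun (n + 1) R T) :
    HasRun n R T := by
  induction n generalizing R T with
  | zero => trivial
  | succ n ih =>
    obtain ⟨i, j, hR, hT, h⟩ := h
    exact ⟨i, j, hR, hT, ih h⟩

theorem HasRun.mono {m n : ℕ} (hmn : m ≤ n) {R T : Fin 3 → Fin 3 → Bool} (h : HasRun n R T) :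
    HasRun m R T := by
  induction hmn with
  | refl => exact h
  | step _ ih => exact ih h.of_succ

theorem updateReach_perm (R : Fin 3 → Fin 3 → Bool) (σ τ : Equiv.Perm (Fin 3)) (i j : Fin 3) :
    updateReach (fun a b => R (σ a) (τ b)) (σ.symm i) (τ.symm j) =
      fun a b => updateReach R i j (σ a) (τ b) := by
  funext a b
  simp [updateReach, Equiv.eq_symm_apply]

theorem HasRun.perm {n : ℕ} {R T : Fin 3 → Fin 3 → Bool} (h : HasRun n R T)
    (σ τ : Equiv.Perm (Fin 3)) :
    HasRun n (fun a b => R (σ a) (τ b)) (fun b a => T (τ b) (σ a)) := by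
  induction n generalizing R T with
  | zero => trivial
  | succ n ih =>
    obtain ⟨i, j, hR, hT, h⟩ := h
    refine ⟨σ.symm i, τ.symm j, by simpa using hR, by simpa using hT, ?_⟩
    rw [updateReach_perm, updateReach_perm T τ σ]
    exact ih h

/-- `f n`, written by recursion on `n` so that the kernel evaluates `n` to a numeral before it passes
it to `f`. -/
def strictApply (n : ℕ) (f : ℕ → Bool) : Bool :=
  Nat.rec (f 0) (fun k _ => f (Nat.succ k)) n

theorem strictApply_eq (n : ℕ) (f : ℕ → Bool) : strictApply n f = f n := by
  cases n <;> rfl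

/-- `updateReach` on matrices coded as numbers below `512`, the entry `(a, b)` being bit `3 * a + b`.
`73` is the mask of column `0`, `511` that of the whole matrix; multiplying column `j` by row `i`
gives the matrix of the entries `R a j && R i b`. -/
def updateCode (i j R : ℕ) : ℕ :=
  Nat.lor
    (Nat.land
      (Nat.lor R (Nat.mul (Nat.land (Nat.shiftRight R j) 73)
        (Nat.land (Nat.shiftRight R (Nat.mul 3 i)) 7)))
      (Nat.sub 511 (Nat.shiftLeft 73 j)))
    (Nat.shiftLeft 1 (Nat.add (Nat.mul 3 i) j))

/-- The Boolean matrix with a given code. -/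
def decodeReach (c : ℕ) (a b : Fin 3) : Bool := Nat.testBit c (3 * a + b)

/-- The entry `(i, j)` of the matrix with code `R`, in terms of functions that the kernel evaluates
natively. -/
def testCode (i j R : ℕ) : Bool :=
  Nat.beq (Nat.land (Nat.shiftRight R (Nat.add (Nat.mul 3 i) j)) 1) 1

theorem updateCode_lt : ∀ R < 512, ∀ i j : Fin 3, updateCode i j R < 512 := by decide +kernel

theorem decodeReach_updateCode : ∀ R < 512, ∀ i j a b : Fin 3,
    decodeReach (updateCode i j R) a b = updateReach (decodeReach R) i j a b := by
  decide +kernel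

theorem testCode_eq : ∀ R < 512, ∀ i j : Fin 3, testCode i j R = decodeReach R i j := by
  decide +kernel

/-- Exhaustive search: `noRun n m k R T` verifies that no run of `n` steps starts from the matrices
with codes `R` and `T`. Only paths `i ≤ m` and `j ≤ k` are tried: the paths of index at least `m`
in the first and at least `k` in the second family are untouched, hence interchangeable. -/
def noRun : ℕ → ℕ → ℕ → ℕ → ℕ → Bool
  | 0, _, _, _, _ => false
  | n + 1, m, k, R, T =>
    let go (i j : ℕ) : Bool :=
      Nat.blt m i || Nat.blt k j || testCode i j R || testCode j i T ||
      strictApply (Nat.max m (Nat.succ i)) fun m' => strictApply (Nat.max k (Nat.succ j)) fun k' =>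
      strictApply (updateCode i j R) fun R' => strictApply (updateCode j i T) fun T' =>
        noRun n m' k' R' T'
    go 0 0 && go 0 1 && go 0 2 && go 1 0 && go 1 1 && go 1 2 && go 2 0 && go 2 1 && go 2 2

theorem noRun_fourteen : noRun 14 0 0 0 0 = true := by decide +kernel

/-- The rows from `m` on and the columns from `k` on of `R` are empty. -/
def SupportedIn (m k : ℕ) (R : Fin 3 → Fin 3 → Bool) : Prop :=
  ∀ a b : Fin 3, (m ≤ a.val ∨ k ≤ b.val) → R a b = false

theorem SupportedIn.updateReach {m k : ℕ} {R : Fin 3 → Fin 3 → Bool} (h : SupportedIn m k R)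
    (i j : Fin 3) : SupportedIn (max m (i + 1)) (max k (j + 1)) (updateReach R i j) := by
  intro a b hab
  rcases hab with ha | hb
  · have hai : a ≠ i := by rintro rfl; omega
    have hr : ∀ c, R a c = false := fun c => h a c (Or.inl (by omega))
    simp [_root_.updateReach, hai, hr]
  · have hbj : b ≠ j := by rintro rfl; omega
    have hr : ∀ c, R c b = false := fun c => h c b (Or.inr (by omega))
    simp [_root_.updateReach, hbj, hr]

/-- If the indices from `m` on are untouched, a relabelling of them moves any `i` to an index at most
`m`. -/
theorem exists_perm_of_unused (m : ℕ) (i : Fin 3) : ∃ (i₀ : Fin 3) (σ : Equiv.Perm (Fin 3)),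
    i₀.val ≤ m ∧ σ.symm i = i₀ ∧ ∀ a, a = σ a ∨ (m ≤ a.val ∧ m ≤ (σ a).val) := by
  by_cases hi : i.val ≤ m
  · exact ⟨i, 1, hi, rfl, fun a => Or.inl rfl⟩
  · refine ⟨⟨m, by omega⟩, Equiv.swap i ⟨m, by omega⟩, le_rfl, by simp, fun a => ?_⟩
    rcases eq_or_ne a i with rfl | h1
    · right; rw [Equiv.swap_apply_left]; exact ⟨by omega, le_rfl⟩
    rcases eq_or_ne a ⟨m, by omega⟩ with rfl | h2
    · right; rw [Equiv.swap_apply_right]; exact ⟨le_rfl, by omega⟩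
    · left; rw [Equiv.swap_apply_of_ne_of_ne h1 h2]

theorem SupportedIn.comp_perm {m k : ℕ} {R : Fin 3 → Fin 3 → Bool} (h : SupportedIn m k R)
    {σ τ : Equiv.Perm (Fin 3)} (hσ : ∀ a, a = σ a ∨ (m ≤ a.val ∧ m ≤ (σ a).val))
    (hτ : ∀ a, a = τ a ∨ (k ≤ a.val ∧ k ≤ (τ a).val)) :
    (fun a b => R (σ a) (τ b)) = R := by
  funext a b
  rcases hσ a with ha | ha
  · rcases hτ b with hb | hb
    · rw [← ha, ← hb]
    · rw [h _ _ (Or.inr hb.1), h _ _ (Or.inr hb.2)]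
  · rw [h _ _ (Or.inl ha.1), h _ _ (Or.inl ha.2)]

theorem noRun_apply {n m k R T : ℕ} (h : noRun (n + 1) m k R T = true) (i j : Fin 3)
    (hi : i.val ≤ m) (hj : j.val ≤ k) (hR : testCode i j R = false) (hT : testCode j i T = false) :
    noRun n (max m (i + 1)) (max k (j + 1)) (updateCode i j R) (updateCode j i T) = true := by
  have hi' : Nat.blt m i.val = false := by
    rw [Bool.eq_false_iff, Ne, Nat.blt_eq]; omega
  have hj' : Nat.blt k j.val = false := by
    rw [Bool.eq_false_iff, Ne, Nat.blt_eq]; omega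
  simp only [noRun, Bool.and_eq_true, strictApply_eq] at h
  have key : (Nat.blt m i || Nat.blt k j || testCode i j R || testCode j i T ||
      noRun n (Nat.max m (Nat.succ i)) (Nat.max k (Nat.succ j)) (updateCode i j R)
        (updateCode j i T)) = true := by
    obtain ⟨⟨⟨⟨⟨⟨⟨⟨h1, h2⟩, h3⟩, h4⟩, h5⟩, h6⟩, h7⟩, h8⟩, h9⟩ := h
    fin_cases i <;> fin_cases j <;> assumption
  simpa only [hi', hj', hR, hT, Bool.false_or] using key

theorem not_hasRun_of_noRun {n m k R T : ℕ} (h : noRun n m k R T = true)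
    (hR : R < 512) (hT : T < 512) (hRs : SupportedIn m k (decodeReach R))
    (hTs : SupportedIn k m (decodeReach T)) : ¬ HasRun n (decodeReach R) (decodeReach T) := by
  induction n generalizing m k R T with
  | zero => simp [noRun] at h
  | succ n ih =>
    rintro ⟨i, j, hRij, hTji, hrun⟩
    obtain ⟨i₀, σ, hi₀, hσi, hσ⟩ := exists_perm_of_unused m i
    obtain ⟨j₀, τ, hj₀, hτj, hτ⟩ := exists_perm_of_unused k j
    have eR := hRs.comp_perm hσ hτ
    have eT := hTs.comp_perm hτ hσ
    have hrun' := hrun.perm σ τ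
    rw [← updateReach_perm, ← updateReach_perm, eR, eT, hσi, hτj] at hrun'
    have hR0 : decodeReach R i₀ j₀ = false := by
      rw [← eR, ← hσi, ← hτj]; simpa using hRij
    have hT0 : decodeReach T j₀ i₀ = false := by
      rw [← eT, ← hσi, ← hτj]; simpa using hTji
    have uR : decodeReach (updateCode i₀ j₀ R) = updateReach (decodeReach R) i₀ j₀ := by
      funext a b; exact decodeReach_updateCode R hR i₀ j₀ a b
    have uT : decodeReach (updateCode j₀ i₀ T) = updateReach (decodeReach T) j₀ i₀ := by
      funext a b; exact decodeReach_updateCode T hT j₀ i₀ a b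
    rw [← uR, ← uT] at hrun'
    refine ih (noRun_apply h i₀ j₀ hi₀ hj₀ ?_ ?_) (updateCode_lt R hR _ _) (updateCode_lt T hT _ _)
      ?_ ?_ hrun'
    · rw [testCode_eq R hR]; exact hR0
    · rw [testCode_eq T hT]; exact hT0
    · rw [uR]; exact hRs.updateReach i₀ j₀
    · rw [uT]; exact hTs.updateReach j₀ i₀

theorem not_hasRun_fourteen : ¬ HasRun 14 (fun _ _ => false) (fun _ _ => false) := by
  have h0 : decodeReach 0 = fun _ _ => false := by funext a b; simp [decodeReach]
  have := not_hasRun_of_noRun noRun_fourteen (by norm_num) (by norm_num)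
    (by intro a b _; rw [h0]) (by intro a b _; rw [h0])
  rwa [h0] at this

/-- `Reached n R T`: some `n` steps lead from the empty matrices to `R` and `T`. -/
inductive Reached : ℕ → (Fin 3 → Fin 3 → Bool) → (Fin 3 → Fin 3 → Bool) → Prop
  | zero : Reached 0 (fun _ _ => false) (fun _ _ => false)
  | step {n : ℕ} {R T : Fin 3 → Fin 3 → Bool} (i j : Fin 3) : Reached n R T → R i j = false →
      T j i = false → Reached (n + 1) (updateReach R i j) (updateReach T j i)

theorem Reached.hasRun {n m : ℕ} {R T : Fin 3 → Fin 3 → Bool} (h : Reached n R T)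
    (hm : HasRun m R T) : HasRun (n + m) (fun _ _ => false) (fun _ _ => false) := by
  induction h generalizing m with
  | zero => simpa using hm
  | @step n R T i j _ hR hT ih =>
    have : n + 1 + m = n + (m + 1) := by ring
    rw [this]
    exact ih ⟨i, j, hR, hT, hm⟩

theorem Reached.le_thirteen {n : ℕ} {R T : Fin 3 → Fin 3 → Bool} (h : Reached n R T) :
    n ≤ 13 := by
  by_contra hn
  exact not_hasRun_fourteen ((h.hasRun (m := 0) trivial).mono (by omega))

/-! ### Linkages and rerouting -/

namespace AcyclicNetwork

variable {G : AcyclicNetwork}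

theorem not_transGen_self (G : AcyclicNetwork) (e : G.E) :
    ¬ Relation.TransGen (fun e f => G.tgt e = G.src f) e e := by
  intro h
  obtain ⟨f, hef, hfe⟩ := Relation.TransGen.tail'_iff.mp h
  obtain ⟨l, hl, hlast⟩ := List.exists_isChain_cons_of_relationReflTransGen hef
  refine G.acyclic (e :: l) hl e rfl f ?_ hfe
  rw [List.getLast?_eq_getLast_of_ne_nil (List.cons_ne_nil e l), hlast]
  rfl

/-- A topological order of the edges, as an injective numbering. -/
theorem exists_topological_numbering (G : AcyclicNetwork) :
    ∃ r : G.E → ℕ, Function.Injective r ∧ ∀ e f, G.tgt e = G.src f → r e < r f := by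
  have := G.finiteE
  let D : G.E → Set G.E := fun e =>
    {a | Relation.TransGen (fun e f => G.tgt e = G.src f) a e}
  let N := Nat.card G.E
  let ι := Finite.equivFin G.E
  have hlt : ∀ e f, G.tgt e = G.src f → (D e).ncard < (D f).ncard := by
    intro e f hef
    refine Set.ncard_lt_ncard ⟨fun a ha => Relation.TransGen.tail ha hef, fun h => ?_⟩ (Set.toFinite _)
    exact G.not_transGen_self e (h (Relation.TransGen.single hef))
  refine ⟨fun e => (D e).ncard * N + ι e, fun e f hef => ?_, fun e f hef => ?_⟩
  · have h1 : (ι e).val < N := (ι e).isLt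
    have h2 : (ι f).val < N := (ι f).isLt
    have h := congrArg (· % N) hef
    simp only [Nat.mul_add_mod_self_right, Nat.mod_eq_of_lt h1, Nat.mod_eq_of_lt h2] at h
    exact ι.injective (Fin.ext h)
  · have h1 : (ι e).val < N := (ι e).isLt
    have := hlt e f hef
    have h3 : ((D e).ncard + 1) * N ≤ (D f).ncard * N := Nat.mul_le_mul_right N this
    have h4 : ((D e).ncard + 1) * N = (D e).ncard * N + N := by ring
    show (D e).ncard * N + (ι e).val < (D f).ncard * N + (ι f).val
    omega

/-- A family of edge-disjoint paths from `u` to `v`, recorded as the set of its edges and the relation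
`next e f` that `f` directly follows `e`. Several paths may pass through one vertex. -/
structure Linkage (G : AcyclicNetwork) (u v : G.V) where
  carrier : Set G.E
  next : G.E → G.E → Prop
  left_mem : ∀ {e f}, next e f → e ∈ carrier
  right_mem : ∀ {e f}, next e f → f ∈ carrier
  adj : ∀ {e f}, next e f → G.tgt e = G.src f
  right_unique : ∀ {e f f'}, next e f → next e f' → f = f'
  left_unique : ∀ {e e' f}, next e f → next e' f → e = e'
  src_eq : ∀ {f}, f ∈ carrier → (∀ e, ¬ next e f) → G.src f = u
  tgt_eq : ∀ {e}, e ∈ carrier → (∀ f, ¬ next e f) → G.tgt e = v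

namespace Linkage

variable {u v u' v' : G.V}

/-- The last edges of the paths of a linkage; there is one for each path. -/
def ends (A : Linkage G u v) : Set G.E := {e | e ∈ A.carrier ∧ ∀ f, ¬ A.next e f}

theorem next_irrefl (A : Linkage G u v) (e : G.E) : ¬ A.next e e := fun h =>
  G.not_transGen_self e (Relation.TransGen.single (A.adj h))

/-- A step of the residual relation of `A` relative to `B`, between edges thought of by their far ends:
backward along `A`; forward along `B` to an edge off `A`; or forward along `B` into an edge `y` of
`A` and at once backward along `A` from `y`, to an edge other than the one left. -/
def Residual (A : Linkage G u v) (B : Linkage G u' v') (x z : G.E) : Prop :=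
  A.next z x ∨ (B.next x z ∧ z ∉ A.carrier) ∨ ∃ y, B.next x y ∧ A.next z y ∧ z ≠ x

/-- The consecutive pairs of edges of either linkage. -/
def arcs (A : Linkage G u v) (B : Linkage G u' v') : Set (G.E × G.E) :=
  {a | A.next a.1 a.2 ∨ B.next a.1 a.2}

section reroute

variable (A : Linkage G u v) (B : Linkage G u' v') (C : Set G.E) (π : G.E → G.E)
  (hC : ∀ x ∈ C, π x ∈ C) (hinj : Set.InjOn π C) (hsurj : ∀ z ∈ C, ∃ x ∈ C, π x = z)
  (hres : ∀ x ∈ C, A.Residual B x (π x))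

/-- Rerouting `A` along residual cycles, given as a permutation `π` of a set `C` of edges. The edges of
`C` from which `π` steps backward along `A` are dropped; from the other edges of `C` the new paths
follow `B`. -/
def reroute : Linkage G u v where
  carrier := {e | (e ∈ A.carrier ∧ e ∉ C) ∨ (e ∈ C ∧ ¬ A.next (π e) e)}
  next e f := (e ∉ C ∧ A.next e f) ∨ (e ∈ C ∧ ¬ A.next (π e) e ∧ B.next e f)
  left_mem := by
    rintro e f (⟨he, h⟩ | ⟨he, hb, -⟩)
    · exact Or.inl ⟨A.left_mem h, he⟩
    · exact Or.inr ⟨he, hb⟩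
  right_mem := by
    rintro e f (⟨he, h⟩ | ⟨he, hb, h⟩)
    · by_cases hf : f ∈ C
      · exact Or.inr ⟨hf, fun hb => he (A.left_unique hb h ▸ hC f hf)⟩
      · exact Or.inl ⟨A.right_mem h, hf⟩
    · rcases hres e he with h1 | ⟨h1, h2⟩ | ⟨y, h1, h2, h3⟩
      · exact absurd h1 hb
      · obtain rfl := B.right_unique h h1
        exact Or.inr ⟨hC e he, fun h4 => h2 (A.right_mem h4)⟩
      · obtain rfl := B.right_unique h h1
        by_cases hf : f ∈ C
        · refine Or.inr ⟨hf, fun h4 => ?_⟩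
          obtain rfl := hinj hf he (A.left_unique h4 h2)
          exact B.next_irrefl _ h
        · exact Or.inl ⟨A.right_mem h2, hf⟩
  adj := by
    rintro e f (⟨-, h⟩ | ⟨-, -, h⟩)
    · exact A.adj h
    · exact B.adj h
  right_unique := by
    rintro e f f' (⟨he, h⟩ | ⟨he, -, h⟩) (⟨he', h'⟩ | ⟨he', -, h'⟩)
    · exact A.right_unique h h'
    · exact absurd he' he
    · exact absurd he he'
    · exact B.right_unique h h'
  left_unique := by
    -- An old and a new predecessor of `f` conflict only if `B` enters `f` in a merging step of `π`,
    -- but then that step leads to the old predecessor, which therefore lies in `C`.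
    have key : ∀ e e' f, e ∉ C → A.next e f → e' ∈ C → ¬ A.next (π e') e' → B.next e' f →
        False := by
      intro e e' f he h he' hb h'
      rcases hres e' he' with h1 | ⟨h1, h2⟩ | ⟨y, h1, h2, -⟩
      · exact hb h1
      · exact h2 (B.right_unique h' h1 ▸ A.right_mem h)
      · obtain rfl := B.right_unique h' h1
        exact he (A.left_unique h2 h ▸ hC e' he')
    rintro e e' f (⟨he, h⟩ | ⟨he, hb, h⟩) (⟨he', h'⟩ | ⟨he', hb', h'⟩)
    · exact A.left_unique h h'
    · exact (key e e' f he h he' hb' h').elim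
    · exact (key e' e f he' h' he hb h).elim
    · exact B.left_unique h h'
  src_eq := by
    intro f hf hno
    by_cases hfA : f ∈ A.carrier
    · refine A.src_eq hfA fun e h => ?_
      by_cases he : e ∈ C
      · obtain ⟨x, hx, rfl⟩ := hsurj e he
        have hxf : x ≠ f := by
          rintro rfl
          rcases hf with hf | hf
          · exact hf.2 hx
          · exact hf.2 h
        have hb : ¬ A.next (π x) x := fun h1 => hxf (A.right_unique h1 h)
        rcases hres x hx with h1 | ⟨h1, h2⟩ | ⟨y, h1, h2, -⟩
        · exact hb h1
        · exact h2 (A.left_mem h)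
        · obtain rfl := A.right_unique h h2
          exact hno x (Or.inr ⟨hx, hb, h1⟩)
      · exact hno e (Or.inl ⟨he, h⟩)
    · rcases hf with hf | ⟨hfC, -⟩
      · exact absurd hf.1 hfA
      · obtain ⟨x, hx, rfl⟩ := hsurj f hfC
        rcases hres x hx with h1 | ⟨h1, h2⟩ | ⟨y, h1, h2, -⟩
        · exact absurd (A.left_mem h1) hfA
        · exact absurd (Or.inr ⟨hx, fun h3 => h2 (A.left_mem h3), h1⟩) (hno x)
        · exact absurd (A.left_mem h2) hfA
  tgt_eq := by
    rintro e (⟨heA, heC⟩ | ⟨heC, hb⟩) hno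
    · exact A.tgt_eq heA fun f h => hno f (Or.inl ⟨heC, h⟩)
    · rcases hres e heC with h1 | ⟨h1, h2⟩ | ⟨y, h1, h2, -⟩
      · exact absurd h1 hb
      · exact absurd (Or.inr ⟨heC, hb, h1⟩) (hno _)
      · exact absurd (Or.inr ⟨heC, hb, h1⟩) (hno _)

theorem ends_reroute : (A.reroute B C π hC hinj hsurj hres).ends = A.ends := by
  ext e
  constructor
  · rintro ⟨⟨heA, heC⟩ | ⟨heC, hb⟩, hno⟩
    · exact ⟨heA, fun f h => hno f (Or.inl ⟨heC, h⟩)⟩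
    · rcases hres e heC with h1 | ⟨h1, h2⟩ | ⟨y, h1, h2, -⟩
      · exact absurd h1 hb
      · exact absurd (Or.inr ⟨heC, hb, h1⟩) (hno _)
      · exact absurd (Or.inr ⟨heC, hb, h1⟩) (hno _)
  · rintro ⟨heA, hno⟩
    have heC : e ∉ C := by
      intro heC
      obtain ⟨x, hx, rfl⟩ := hsurj e heC
      rcases hres x hx with h1 | ⟨h1, h2⟩ | ⟨y, h1, h2, -⟩
      · exact hno _ h1
      · exact h2 heA
      · exact hno _ h2
    refine ⟨Or.inl ⟨heA, heC⟩, ?_⟩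
    rintro f (⟨-, h⟩ | ⟨h, -⟩)
    · exact hno f h
    · exact heC h

include hC hsurj hres in
/-- Residual cycles contain a step of the third kind: consider a topologically last edge of `C`. -/
theorem exists_switch (hne : C.Nonempty) :
    ∃ x ∈ C, ∃ y, B.next x y ∧ A.next (π x) y ∧ π x ≠ x := by
  have := G.finiteE
  obtain ⟨r, -, hr⟩ := G.exists_topological_numbering
  obtain ⟨e, heC, hmax⟩ := (Set.toFinite C).exists_maximalFor r C hne
  have hmax' : ∀ x ∈ C, ¬ r e < r x := fun x hx hlt => absurd (hmax hx hlt.le) (by omega)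
  rcases hres e heC with h1 | ⟨h1, h2⟩ | h
  · obtain ⟨x, hx, hxe⟩ := hsurj e heC
    rcases hres x hx with h3 | ⟨h3, h4⟩ | h
    · rw [hxe] at h3
      exact absurd (hr _ _ (A.adj h3)) (hmax' x hx)
    · rw [hxe] at h4
      exact absurd (A.right_mem h1) h4
    · exact ⟨x, hx, h⟩
  · exact absurd (hr _ _ (B.adj h1)) (hmax' _ (hC e heC))
  · exact ⟨e, heC, h⟩

theorem arcs_reroute_ssubset (hne : C.Nonempty) :
    (A.reroute B C π hC hinj hsurj hres).arcs B ⊂ A.arcs B := by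
  obtain ⟨x, hx, y, h1, h2, h3⟩ := exists_switch A B C π hC hsurj hres hne
  refine ⟨?_, fun h => ?_⟩
  · rintro ⟨e, f⟩ ((⟨-, h⟩ | ⟨-, -, h⟩) | h)
    · exact Or.inl h
    · exact Or.inr h
    · exact Or.inr h
  · have : (π x, y) ∈ A.arcs B := Or.inl h2
    rcases h this with (⟨h4, -⟩ | ⟨-, -, h4⟩) | h4
    · exact h4 (hC x hx)
    · exact h3 (B.left_unique h4 h1)
    · exact h3 (B.left_unique h4 h1)

end reroute

/-- A residual relation that is not well-founded has a nonempty set on which a choice of successors is a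
permutation, namely the periodic points of such a choice; rerouting along it saves a pair. -/
theorem exists_arcs_ssubset_of_not_wellFounded (A : Linkage G u v) (B : Linkage G u' v')
    (h : ¬ WellFounded (flip (A.Residual B))) :
    ∃ A' : Linkage G u v, A'.ends = A.ends ∧ A'.arcs B ⊂ A.arcs B := by
  classical
  have := G.finiteE
  rw [WellFounded.wellFounded_iff_has_min] at h
  push Not at h
  obtain ⟨S, ⟨s, hs⟩, hS⟩ := h
  choose! f hfS hf using hS
  let g : S → S := fun x => ⟨f x, hfS x x.2⟩
  let P := Function.periodicPts g
  have hP := Function.bijOn_periodicPts (f := g)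
  have hPne : P.Nonempty := by
    obtain ⟨m, n, hmn, hg⟩ := Finite.exists_ne_map_eq_of_infinite (fun n : ℕ => g^[n] ⟨s, hs⟩)
    wlog hlt : m < n generalizing m n
    · exact this n m hmn.symm hg.symm (by omega)
    refine ⟨g^[m] ⟨s, hs⟩, n - m, by omega, ?_⟩
    show g^[n - m] (g^[m] ⟨s, hs⟩) = g^[m] ⟨s, hs⟩
    rw [← Function.iterate_add_apply, Nat.sub_add_cancel hlt.le]
    exact hg.symm
  let C : Set G.E := Subtype.val '' P
  have hC : ∀ x ∈ C, f x ∈ C := by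
    rintro _ ⟨x, hx, rfl⟩
    exact ⟨g x, hP.mapsTo hx, rfl⟩
  have hinj : Set.InjOn f C := by
    rintro _ ⟨x, hx, rfl⟩ _ ⟨y, hy, rfl⟩ hxy
    exact congrArg _ (hP.injOn hx hy (Subtype.ext hxy))
  have hsurj : ∀ z ∈ C, ∃ x ∈ C, f x = z := by
    rintro _ ⟨z, hz, rfl⟩
    obtain ⟨x, hx, rfl⟩ := hP.surjOn hz
    exact ⟨x, ⟨x, hx, rfl⟩, rfl⟩
  have hres : ∀ x ∈ C, A.Residual B x (f x) := by
    rintro _ ⟨x, hx, rfl⟩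
    exact hf x x.2
  exact ⟨A.reroute B C f hC hinj hsurj hres, A.ends_reroute .., A.arcs_reroute_ssubset _ _ _ _ _ _ _ (hPne.image _)⟩

end Linkage
end AcyclicNetwork

/-! ### Potentials and labels -/

namespace AcyclicNetwork

variable {G : AcyclicNetwork}

/-- A map `t` sending each edge to the end of the maximal chain of a partial successor relation `N`
that starts there. -/
theorem exists_terminal_map {N : G.E → G.E → Prop}
    (hadj : ∀ {e f}, N e f → G.tgt e = G.src f) (hr : ∀ {e f f'}, N e f → N e f' → f = f') :
    ∃ t : G.E → G.E, (∀ e, Relation.ReflTransGen N e (t e)) ∧ (∀ e f, ¬ N (t e) f) ∧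
      (∀ e f, N e f → t e = t f) ∧ ∀ e, (∀ f, ¬ N e f) → t e = e := by
  have := G.finiteE
  obtain ⟨r, -, hrk⟩ := G.exists_topological_numbering
  have ex : ∀ e, ∃ t, Relation.ReflTransGen N e t ∧ ∀ f, ¬ N t f := by
    intro e
    obtain ⟨t, ht, hmax⟩ := (Set.toFinite {t | Relation.ReflTransGen N e t}).exists_maximalFor r _
      ⟨e, Relation.ReflTransGen.refl⟩
    refine ⟨t, ht, fun f hf => ?_⟩
    have h1 := hrk _ _ (hadj hf)
    have h2 := hmax (Relation.ReflTransGen.tail ht hf) h1.le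
    omega
  choose t ht hterm using ex
  have huniq : ∀ e s, Relation.ReflTransGen N e s → (∀ f, ¬ N s f) → t e = s := by
    intro e s hs hs'
    have hru : Relator.RightUnique N := fun _ _ _ h1 h2 => hr h1 h2
    rcases Relation.ReflTransGen.total_of_right_unique hru (ht e) hs with h | h
    · rcases Relation.ReflTransGen.cases_head h with h | ⟨f, h, -⟩
      · exact h
      · exact absurd h (hterm e f)
    · rcases Relation.ReflTransGen.cases_head h with h | ⟨f, h, -⟩
      · exact h.symm
      · exact absurd h (hs' f)
  exact ⟨t, ht, hterm, fun e f h => huniq e _ (Relation.ReflTransGen.head h (ht f)) (hterm f),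
    fun e h => huniq e e Relation.ReflTransGen.refl h⟩

namespace Linkage

variable {u v u' v' : G.V}

/-- The inequalities that the residual relation of `A` relative to `B` imposes on a potential. They are
weak, except at mergings, so that the potential can be constant on segments shared by `A` and `B`. -/
structure IsPotential (A : Linkage G u v) (B : Linkage G u' v') (h : G.E → Ordinal.{0}) : Prop where
  le_of_next : ∀ {z x}, A.next z x → h z ≤ h x
  le_of_next_of_notMem : ∀ {x y}, B.next x y → y ∉ A.carrier → h y ≤ h x
  lt_of_merge : ∀ {x y z}, B.next x y → A.next z y → z ≠ x → h z < h x
  eq_of_shared : ∀ {x y}, A.next x y → B.next x y → h x = h y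

/-- The potential of an edge is the rank, in the residual relation, of the last edge of its shared
segment. -/
theorem exists_isPotential (A : Linkage G u v) (B : Linkage G u' v')
    (hwf : WellFounded (flip (A.Residual B))) : ∃ h, A.IsPotential B h := by
  obtain ⟨t, ht, -, heq, hself⟩ := exists_terminal_map (N := fun e f => A.next e f ∧ B.next e f)
    (fun h => A.adj h.1) (fun h h' => A.right_unique h.1 h'.1)
  have : IsWellFounded G.E (flip (A.Residual B)) := ⟨hwf⟩
  let rank : G.E → Ordinal.{0} := IsWellFounded.rank (flip (A.Residual B))
  have lt_rank : ∀ {x z}, A.Residual B x z → rank z < rank x :=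
    fun h => IsWellFounded.rank_lt_of_rel h
  have le_rank : ∀ e, rank e ≤ rank (t e) := by
    have mono : ∀ {e f}, Relation.ReflTransGen (fun e f => A.next e f ∧ B.next e f) e f →
        rank e ≤ rank f := by
      intro e f h
      induction h with
      | refl => exact le_rfl
      | tail _ h ih => exact ih.trans (lt_rank (Or.inl h.1)).le
    exact fun e => mono (ht e)
  refine ⟨fun e => rank (t e), ?_, ?_, ?_, ?_⟩
  · intro z x h
    by_cases hs : B.next z x
    · exact (congrArg rank (heq z x ⟨h, hs⟩)).le
    · have hz : t z = z := hself z fun w hw => hs (A.right_unique hw.1 h ▸ hw.2)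
      show rank (t z) ≤ _
      rw [hz]
      exact (lt_rank (Or.inl h)).le.trans (le_rank x)
  · intro x y h hy
    have hx : t x = x := hself x fun w hw => hy (B.right_unique hw.2 h ▸ A.right_mem hw.1)
    have hy' : t y = y := hself y fun w hw => hy (A.left_mem hw.1)
    show rank (t y) ≤ rank (t x)
    rw [hx, hy']
    exact (lt_rank (Or.inr (Or.inl ⟨h, hy⟩))).le
  · intro x y z hx hz hzx
    have hx' : t x = x := hself x fun w hw =>
      hzx (A.left_unique hz (B.right_unique hw.2 hx ▸ hw.1))
    have hz' : t z = z := hself z fun w hw =>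
      hzx (B.left_unique (A.right_unique hw.1 hz ▸ hw.2) hx)
    show rank (t z) < rank (t x)
    rw [hx', hz']
    exact lt_rank (Or.inr (Or.inr ⟨y, hx, hz, hzx⟩))
  · intro x y hA hB
    exact congrArg rank (heq x y ⟨hA, hB⟩)

/-- A labelling of at most three paths by `Fin 3`, obtained by labelling their last edges. The first edge
of a path precedes all other edges with its label. -/
theorem exists_label (A : Linkage G u v) (hA : A.ends.ncard ≤ 3) {r : G.E → ℕ}
    (hr : ∀ e f, G.tgt e = G.src f → r e < r f) :
    ∃ l : G.E → Fin 3, (∀ {z y}, A.next z y → l z = l y) ∧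
      ∀ {y y'}, y ∈ A.carrier → y' ∈ A.carrier → l y = l y' → (∀ z, ¬ A.next z y) → r y ≤ r y' := by
  have := G.finiteE
  obtain ⟨t, ht, hterm, heq, -⟩ := exists_terminal_map (N := A.next) A.adj A.right_unique
  have hmem : ∀ {e f}, e ∈ A.carrier → Relation.ReflTransGen A.next e f → f ∈ A.carrier := by
    intro e f he h
    induction h with
    | refl => exact he
    | tail _ h _ => exact A.right_mem h
  obtain ⟨ι, hι⟩ : ∃ ι : G.E → Fin 3, Set.InjOn ι A.ends := by
    obtain ⟨ι, -, hι⟩ := (Set.toFinite A.ends).exists_injOn_of_encard_le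
      (t := (Set.univ : Set (Fin 3))) (by
        have h3 : (A.ends.ncard : ℕ∞) ≤ 3 := by exact_mod_cast hA
        rw [(Set.toFinite A.ends).cast_ncard_eq] at h3
        simpa using h3)
    exact ⟨ι, hι⟩
  refine ⟨fun e => ι (t e), fun h => congrArg ι (heq _ _ h), fun {y y'} hy hy' hl hinit => ?_⟩
  have hty : t y = t y' := hι ⟨hmem hy (ht y), hterm y⟩ ⟨hmem hy' (ht y'), hterm y'⟩ hl
  have hlu : Relator.RightUnique (Function.swap A.next) := fun _ _ _ h1 h2 => A.left_unique h1 h2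
  have h1 := Relation.reflTransGen_swap.mpr (ht y)
  have h2 := Relation.reflTransGen_swap.mpr (ht y')
  rw [hty] at h1
  have mono : ∀ {e f}, Relation.ReflTransGen A.next e f → r e ≤ r f := by
    intro e f h
    induction h with
    | refl => exact le_rfl
    | tail _ h ih => exact ih.trans (hr _ _ (A.adj h)).le
  rcases Relation.ReflTransGen.total_of_right_unique hlu h1 h2 with h | h
  · rcases Relation.ReflTransGen.cases_head h with h | ⟨f, h, -⟩
    · rw [h]
    · exact absurd h (hinit f)
  · exact mono (Relation.reflTransGen_swap.mp h)

end Linkage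
end AcyclicNetwork

/-! ### Sweeping the edges in topological order -/

namespace AcyclicNetwork

variable {G : AcyclicNetwork}

open Function (update)

/-- All entries of `R` are true of the current last edges `p a` and `q b` on the paths of the two
families (`none` for a path not yet begun) and the potential `h`. -/
def ReachSound {E : Type} (R : Fin 3 → Fin 3 → Bool) (p q : Fin 3 → Option E) (h : E → Ordinal.{0}) :
    Prop :=
  ∀ a b, R a b = true → ∃ z x, p a = some z ∧ q b = some x ∧ h x ≤ h z

namespace ReachSound

variable {E : Type} {R : Fin 3 → Fin 3 → Bool} {p q : Fin 3 → Option E} {h : E → Ordinal.{0}}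

theorem update_left (hs : ReachSound R p q h) {i : Fin 3} {y : E}
    (hy : ∀ z, p i = some z → h z ≤ h y) : ReachSound R (update p i (some y)) q h := by
  intro a b hab
  obtain ⟨z, x, hz, hx, hzx⟩ := hs a b hab
  by_cases ha : a = i
  · subst ha
    exact ⟨y, x, by simp, hx, hzx.trans (hy z hz)⟩
  · exact ⟨z, x, by simpa [ha] using hz, hx, hzx⟩

theorem update_right (hs : ReachSound R p q h) {j : Fin 3} {y : E}
    (hy : ∀ x, q j = some x → h y ≤ h x) : ReachSound R p (update q j (some y)) h := by
  intro a b hab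
  obtain ⟨z, x, hz, hx, hzx⟩ := hs a b hab
  by_cases hb : b = j
  · subst hb
    exact ⟨z, y, hz, by simp, (hy x hx).trans hzx⟩
  · exact ⟨z, x, hz, by simpa [hb] using hx, hzx⟩

theorem eq_false (hs : ReachSound R p q h) {i j : Fin 3}
    (hlt : ∀ z x, p i = some z → q j = some x → h z < h x) : R i j = false := by
  rw [Bool.eq_false_iff]
  intro hR
  obtain ⟨z, x, hz, hx, hzx⟩ := hs i j hR
  exact absurd hzx (not_le.mpr (hlt z x hz hx))

theorem updateReach (hs : ReachSound R p q h) {i j : Fin 3} {y : E}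
    (hlt : ∀ z x, p i = some z → q j = some x → h z < h x)
    (hy : ∀ z, p i = some z → h z ≤ h y) :
    ReachSound (updateReach R i j) (update p i (some y)) (update q j (some y)) h := by
  intro a b hab
  by_cases hb : b = j
  · subst hb
    have ha : a = i := by simpa [_root_.updateReach] using hab
    subst ha
    exact ⟨y, y, by simp, by simp, le_rfl⟩
  · have hs' := hs.update_left hy
    have hab' : R a b = true ∨ R a j = true ∧ R i b = true := by
      simpa [_root_.updateReach, hb] using hab
    rcases hab' with hab' | ⟨h1, h2⟩
    · obtain ⟨z, x, hz, hx, hzx⟩ := hs' a b hab'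
      exact ⟨z, x, hz, by simpa [hb] using hx, hzx⟩
    · obtain ⟨z, x, hz, hx, hzx⟩ := hs' a j h1
      obtain ⟨z', x', hz', hx', hzx'⟩ := hs i b h2
      exact ⟨z, x', hz, by simpa [hb] using hx', hzx'.trans ((hlt z' x hz' hx).le.trans hzx)⟩

end ReachSound

namespace Linkage

variable {u v u' v' : G.V}

/-- `l` numbers the paths of `A`, where `r` is a topological numbering of the edges. -/
structure IsLabelling (A : Linkage G u v) (r : G.E → ℕ) (l : G.E → Fin 3) : Prop where
  eq_of_next : ∀ {z y}, A.next z y → l z = l y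
  le_of_initial : ∀ {y y'}, y ∈ A.carrier → y' ∈ A.carrier → l y = l y' →
    (∀ z, ¬ A.next z y) → r y ≤ r y'

/-- When the edges `e` with `r e < t` have been swept, `p i` is the last one of them on path `i`. -/
structure IsFrontier (A : Linkage G u v) (r : G.E → ℕ) (l : G.E → Fin 3) (t : ℕ)
    (p : Fin 3 → Option G.E) : Prop where
  mem : ∀ {i z}, p i = some z → z ∈ A.carrier ∧ l z = i ∧ r z < t
  pred : ∀ {y z}, A.next z y → t ≤ r y → r z < t → p (l y) = some z

variable {A : Linkage G u v} {B : Linkage G u' v'} {r : G.E → ℕ} {l : G.E → Fin 3} {t : ℕ}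
  {p : Fin 3 → Option G.E}

theorem IsFrontier.next_of_eq_some (hp : A.IsFrontier r l t p) (hl : A.IsLabelling r l)
    (hr : ∀ e f, G.tgt e = G.src f → r e < r f) {y z : G.E} (hy : y ∈ A.carrier) (ht : r y = t)
    (hz : p (l y) = some z) : A.next z y := by
  by_cases hex : ∃ w, A.next w y
  · obtain ⟨w, hw⟩ := hex
    have := hp.pred hw ht.ge (ht ▸ hr _ _ (A.adj hw))
    rw [hz] at this
    exact Option.some.inj this ▸ hw
  · push Not at hex
    obtain ⟨h1, h2, h3⟩ := hp.mem hz
    have := hl.le_of_initial hy h1 h2.symm hex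
    omega

theorem IsFrontier.eq_some_of_next (hp : A.IsFrontier r l t p)
    (hr : ∀ e f, G.tgt e = G.src f → r e < r f) {y z : G.E} (ht : r y = t)
    (hz : A.next z y) : p (l y) = some z :=
  hp.pred hz ht.ge (ht ▸ hr _ _ (A.adj hz))

theorem IsFrontier.skip (hp : A.IsFrontier r l t p) (ht : ∀ y ∈ A.carrier, r y ≠ t) :
    A.IsFrontier r l (t + 1) p where
  mem := fun h => ⟨(hp.mem h).1, (hp.mem h).2.1, (hp.mem h).2.2.trans (Nat.lt_succ_self t)⟩
  pred := fun {y z} h h1 h2 => hp.pred h (by omega) (by have := ht z (A.left_mem h); omega)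

theorem IsFrontier.advance (hp : A.IsFrontier r l t p) (hl : A.IsLabelling r l)
    (hinj : Function.Injective r) (hr : ∀ e f, G.tgt e = G.src f → r e < r f) {y : G.E}
    (hy : y ∈ A.carrier) (ht : r y = t) :
    A.IsFrontier r l (t + 1) (update p (l y) (some y)) where
  mem := by
    intro i z hz
    by_cases hi : i = l y
    · subst hi
      rw [Function.update_self] at hz
      obtain rfl := Option.some.inj hz
      exact ⟨hy, rfl, by omega⟩
    · rw [Function.update_of_ne hi] at hz
      obtain ⟨h1, h2, h3⟩ := hp.mem hz
      exact ⟨h1, h2, by omega⟩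
  pred := by
    intro y' z h h1 h2
    rcases Nat.lt_succ_iff_lt_or_eq.mp h2 with h3 | h3
    · have hz := hp.pred h (by omega) h3
      have hne : l y' ≠ l y := by
        intro he
        rw [he] at hz
        have := A.right_unique (hp.next_of_eq_some hl hr hy ht hz) h
        subst this
        omega
      rwa [Function.update_of_ne hne]
    · obtain rfl : z = y := hinj (h3.trans ht.symm)
      rw [← hl.eq_of_next h, Function.update_self]

/-- The first edges of the segments shared by `A` and `B`. Every merging is one of them; the others are
first edges of a path of `A` or of `B`. -/
def sharedStarts (A : Linkage G u v) (B : Linkage G u' v') : Set G.E :=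
  {e | e ∈ A.carrier ∧ e ∈ B.carrier ∧ ∀ f, A.next f e → ¬ B.next f e}

/-- While the edges are swept, the machine has made at least as many steps as shared segments have been
met, and its matrices remain true of the frontiers. -/
theorem exists_reached_sweep {l' : G.E → Fin 3} {h h' : G.E → Ordinal.{0}}
    (hinj : Function.Injective r) (hr : ∀ e f, G.tgt e = G.src f → r e < r f)
    (hl : A.IsLabelling r l) (hl' : B.IsLabelling r l')
    (hh : A.IsPotential B h) (hh' : B.IsPotential A h') (t : ℕ) :
    ∃ n R T p q, Reached n R T ∧ (A.sharedStarts B ∩ {e | r e < t}).encard ≤ n ∧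
      A.IsFrontier r l t p ∧ B.IsFrontier r l' t q ∧ ReachSound R p q h ∧ ReachSound T q p h' := by
  induction t with
  | zero =>
    refine ⟨0, _, _, fun _ => none, fun _ => none, Reached.zero, by simp, ⟨?_, ?_⟩, ⟨?_, ?_⟩, ?_, ?_⟩
    · intro i z hz; simp at hz
    · intro y z _ _ h; omega
    · intro i z hz; simp at hz
    · intro y z _ _ h; omega
    · intro a b hab; simp at hab
    · intro a b hab; simp at hab
  | succ t ih =>
    obtain ⟨n, R, T, p, q, hreach, hcard, hp, hq, hR, hT⟩ := ih
    have same : (∀ y, r y = t → y ∉ A.sharedStarts B) →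
        (A.sharedStarts B ∩ {e | r e < t + 1}).encard ≤ n := by
      intro hno
      refine (Set.encard_le_encard ?_).trans hcard
      rintro e ⟨he, het⟩
      refine ⟨he, lt_of_le_of_ne (Nat.lt_succ_iff.mp het) fun h => hno e h he⟩
    by_cases hy : ∃ y, r y = t
    · obtain ⟨y, hyt⟩ := hy
      have huniq : ∀ y', r y' = t → y' = y := fun y' h => hinj (h.trans hyt.symm)
      by_cases hyA : y ∈ A.carrier
      · have hpn : ∀ z, p (l y) = some z → A.next z y := fun z hz =>
          hp.next_of_eq_some hl hr hyA hyt hz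
        have hp' := hp.advance hl hinj hr hyA hyt
        by_cases hyB : y ∈ B.carrier
        · have hqn : ∀ z, q (l' y) = some z → B.next z y := fun z hz =>
            hq.next_of_eq_some hl' hr hyB hyt hz
          have hq' := hq.advance hl' hinj hr hyB hyt
          by_cases hstart : y ∈ A.sharedStarts B
          · have hne : ∀ z x, p (l y) = some z → q (l' y) = some x → z ≠ x := by
              rintro z x hz hx rfl
              exact hstart.2.2 z (hpn z hz) (hqn z hx)
            have hlt : ∀ z x, p (l y) = some z → q (l' y) = some x → h z < h x :=
              fun z x hz hx => hh.lt_of_merge (hqn x hx) (hpn z hz) (hne z x hz hx)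
            have hlt' : ∀ x z, q (l' y) = some x → p (l y) = some z → h' x < h' z :=
              fun x z hx hz => hh'.lt_of_merge (hpn z hz) (hqn x hx) (hne z x hz hx).symm
            refine ⟨n + 1, _, _, _, _,
              hreach.step (l y) (l' y) (hR.eq_false hlt) (hT.eq_false hlt'), ?_, hp', hq',
              hR.updateReach hlt fun z hz => hh.le_of_next (hpn z hz),
              hT.updateReach hlt' fun z hz => hh'.le_of_next (hqn z hz)⟩
            have hsub : A.sharedStarts B ∩ {e | r e < t + 1} ⊆
                insert y (A.sharedStarts B ∩ {e | r e < t}) := by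
              rintro e ⟨he, het⟩
              rcases Nat.lt_succ_iff_lt_or_eq.mp het with h3 | h3
              · exact Or.inr ⟨he, h3⟩
              · exact Or.inl (huniq e h3)
            refine (Set.encard_le_encard hsub).trans ((Set.encard_insert_le _ _).trans ?_)
            push_cast
            gcongr
          · obtain ⟨f, hfA, hfB⟩ : ∃ f, A.next f y ∧ B.next f y := by
              by_contra hno
              push Not at hno
              exact hstart ⟨hyA, hyB, hno⟩
            have hpf := hp.eq_some_of_next hr hyt hfA
            have hqf := hq.eq_some_of_next hr hyt hfB
            have e1 := hh.eq_of_shared hfA hfB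
            have e2 := hh'.eq_of_shared hfB hfA
            refine ⟨n, R, T, _, _, hreach, same fun y' h' => huniq y' h' ▸ hstart, hp', hq',
              (hR.update_left fun z hz => hh.le_of_next (hpn z hz)).update_right fun x hx => ?_,
              (hT.update_left fun z hz => hh'.le_of_next (hqn z hz)).update_right fun x hx => ?_⟩
            · rw [hqf] at hx
              exact (Option.some.inj hx ▸ e1).ge
            · rw [hpf] at hx
              exact (Option.some.inj hx ▸ e2).ge
        · refine ⟨n, R, T, _, q, hreach, same fun y' h' => huniq y' h' ▸ fun h => hyB h.2.1, hp',
            hq.skip fun y' hy' h' => hyB (huniq y' h' ▸ hy'),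
            hR.update_left fun z hz => hh.le_of_next (hpn z hz),
            hT.update_right fun z hz => hh'.le_of_next_of_notMem (hpn z hz) hyB⟩
      · have hpskip := hp.skip fun y' hy' h' => hyA (huniq y' h' ▸ hy')
        have hno := same fun y' h' => huniq y' h' ▸ fun h => hyA h.1
        by_cases hyB : y ∈ B.carrier
        · have hqn : ∀ z, q (l' y) = some z → B.next z y := fun z hz =>
            hq.next_of_eq_some hl' hr hyB hyt hz
          exact ⟨n, R, T, p, _, hreach, hno, hpskip, hq.advance hl' hinj hr hyB hyt,
            hR.update_right fun z hz => hh.le_of_next_of_notMem (hqn z hz) hyA,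
            hT.update_left fun z hz => hh'.le_of_next (hqn z hz)⟩
        · exact ⟨n, R, T, p, q, hreach, hno, hpskip,
            hq.skip fun y' hy' h' => hyB (huniq y' h' ▸ hy'), hR, hT⟩
    · push Not at hy
      exact ⟨n, R, T, p, q, hreach, same fun y h => absurd h (hy y), hp.skip fun y _ => hy y,
        hq.skip fun y _ => hy y, hR, hT⟩

theorem encard_sharedStarts_le (A : Linkage G u v) (B : Linkage G u' v')
    (hA : A.ends.ncard ≤ 3) (hB : B.ends.ncard ≤ 3)
    (hAB : WellFounded (flip (A.Residual B))) (hBA : WellFounded (flip (B.Residual A))) :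
    (A.sharedStarts B).encard ≤ 13 := by
  have := G.finiteE
  obtain ⟨r, hinj, hr⟩ := G.exists_topological_numbering
  obtain ⟨l, h1, h2⟩ := A.exists_label hA hr
  obtain ⟨l', h1', h2'⟩ := B.exists_label hB hr
  obtain ⟨h, hh⟩ := A.exists_isPotential B hAB
  obtain ⟨h', hh'⟩ := B.exists_isPotential A hBA
  obtain ⟨t, ht⟩ := (Set.finite_range r).bddAbove
  obtain ⟨n, R, T, p, q, hreach, hcard, -⟩ :=
    exists_reached_sweep hinj hr ⟨h1, h2⟩ ⟨h1', h2'⟩ hh hh' (t + 1)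
  have hall : {e | r e < t + 1} = Set.univ :=
    Set.eq_univ_of_forall fun e => Nat.lt_succ_iff.mpr (ht ⟨e, rfl⟩)
  rw [hall, Set.inter_univ] at hcard
  exact hcard.trans (by exact_mod_cast hreach.le_thirteen)

end Linkage
end AcyclicNetwork

/-! ### Path families and the upper bound -/

namespace AcyclicNetwork

variable {G : AcyclicNetwork}

theorem pair_infix_iff {E : Type*} {l : List E} {e f : E} :
    [e, f] <:+: l ↔ ∃ n, l[n]? = some e ∧ l[n + 1]? = some f := by
  constructor
  · rintro ⟨s, t, rfl⟩
    exact ⟨s.length, by simp, by simp⟩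
  · rintro ⟨n, h1, h2⟩
    obtain ⟨hn, rfl⟩ := List.getElem?_eq_some_iff.mp h1
    obtain ⟨hn', rfl⟩ := List.getElem?_eq_some_iff.mp h2
    refine ⟨l.take n, l.drop (n + 2), ?_⟩
    rw [List.append_assoc, List.cons_append, List.cons_append, List.nil_append,
      ← List.drop_eq_getElem_cons hn', ← List.drop_eq_getElem_cons hn, List.take_append_drop]

namespace IsPath

variable {u v : G.V} {l : List G.E}

theorem nodup (h : G.IsPath u v l) : l.Nodup := by
  obtain ⟨r, -, hr⟩ := G.exists_topological_numbering
  have h1 : l.IsChain fun e f => r e < r f := h.1.imp fun e f hef => hr e f hef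
  have : IsTrans G.E fun e f => r e < r f := ⟨fun _ _ _ h h' => h.trans h'⟩
  have h2 := List.isChain_iff_pairwise.mp h1
  exact h2.imp fun {a b} hab he => by subst he; exact lt_irrefl _ hab

theorem adj (h : G.IsPath u v l) {e f : G.E} (hef : [e, f] <:+: l) : G.tgt e = G.src f := by
  have := h.1.infix hef
  simpa using this

theorem src_eq (h : G.IsPath u v l) {f : G.E} (hf : f ∈ l) (hno : ∀ e, ¬ [e, f] <:+: l) :
    G.src f = u := by
  obtain ⟨-, ⟨e, he, hu⟩, -⟩ := h
  obtain ⟨n, hn, rfl⟩ := List.getElem_of_mem hf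
  cases n with
  | zero =>
    rw [List.head?_eq_getElem?] at he
    obtain ⟨_, rfl⟩ := List.getElem?_eq_some_iff.mp he
    exact hu
  | succ n =>
    exact absurd (pair_infix_iff.mpr ⟨n, List.getElem?_eq_getElem (by omega),
      List.getElem?_eq_getElem hn⟩) (hno _)

theorem tgt_eq (h : G.IsPath u v l) {e : G.E} (he : e ∈ l) (hno : ∀ f, ¬ [e, f] <:+: l) :
    G.tgt e = v := by
  obtain ⟨-, -, ⟨f, hf, hv⟩⟩ := h
  obtain ⟨n, hn, rfl⟩ := List.getElem_of_mem he
  rw [List.getLast?_eq_getElem?] at hf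
  obtain ⟨h', rfl⟩ := List.getElem?_eq_some_iff.mp hf
  by_cases hlast : n = l.length - 1
  · subst hlast
    exact hv
  · exact absurd (pair_infix_iff.mpr ⟨n, List.getElem?_eq_getElem hn,
      List.getElem?_eq_getElem (by omega)⟩) (hno _)

theorem pair_right_unique (h : G.IsPath u v l) {e f f' : G.E} (h1 : [e, f] <:+: l)
    (h2 : [e, f'] <:+: l) : f = f' := by
  obtain ⟨n, hn, hn'⟩ := pair_infix_iff.mp h1
  obtain ⟨m, hm, hm'⟩ := pair_infix_iff.mp h2
  have hlt := (List.getElem?_eq_some_iff.mp hn).1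
  obtain rfl := (List.getElem?_inj hlt h.nodup).mp (hn.trans hm.symm)
  exact Option.some.inj (hn'.symm.trans hm')

theorem pair_left_unique (h : G.IsPath u v l) {e e' f : G.E} (h1 : [e, f] <:+: l)
    (h2 : [e', f] <:+: l) : e = e' := by
  obtain ⟨n, hn, hn'⟩ := pair_infix_iff.mp h1
  obtain ⟨m, hm, hm'⟩ := pair_infix_iff.mp h2
  have hlt := (List.getElem?_eq_some_iff.mp hn').1
  have := (List.getElem?_inj hlt h.nodup).mp (hn'.trans hm'.symm)
  obtain rfl : n = m := by omega
  exact Option.some.inj (hn.symm.trans hm)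

end IsPath

theorem IsDisjointPaths.index_unique {u v : G.V} {k : ℕ} {α : Fin k → List G.E}
    (h : G.IsDisjointPaths u v α) {i j : Fin k} {e : G.E} (hi : e ∈ α i) (hj : e ∈ α j) : i = j := by
  by_contra hij
  exact h.2 hij hi hj

theorem left_mem_of_pair_infix {E : Type*} {l : List E} {e f : E} (h : [e, f] <:+: l) : e ∈ l :=
  h.subset (by simp)

theorem right_mem_of_pair_infix {E : Type*} {l : List E} {e f : E} (h : [e, f] <:+: l) : f ∈ l :=
  h.subset (by simp)

namespace Linkage

variable {u v u' v' : G.V}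

/-- The linkage of a family of edge-disjoint paths. -/
def ofPaths {k : ℕ} {α : Fin k → List G.E} (h : G.IsDisjointPaths u v α) : Linkage G u v where
  carrier := {e | ∃ i, e ∈ α i}
  next e f := ∃ i, [e, f] <:+: α i
  left_mem := fun ⟨i, hi⟩ => ⟨i, left_mem_of_pair_infix hi⟩
  right_mem := fun ⟨i, hi⟩ => ⟨i, right_mem_of_pair_infix hi⟩
  adj := fun ⟨i, hi⟩ => (h.1 i).adj hi
  right_unique := by
    rintro e f f' ⟨i, hi⟩ ⟨j, hj⟩
    obtain rfl := h.index_unique (left_mem_of_pair_infix hi) (left_mem_of_pair_infix hj)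
    exact (h.1 i).pair_right_unique hi hj
  left_unique := by
    rintro e f f' ⟨i, hi⟩ ⟨j, hj⟩
    obtain rfl := h.index_unique (right_mem_of_pair_infix hi) (right_mem_of_pair_infix hj)
    exact (h.1 i).pair_left_unique hi hj
  src_eq := by
    rintro f ⟨i, hi⟩ hno
    exact (h.1 i).src_eq hi fun e he => hno e ⟨i, he⟩
  tgt_eq := by
    rintro f ⟨i, hi⟩ hno
    exact (h.1 i).tgt_eq hi fun e he => hno e ⟨i, he⟩

theorem le_ncard_ends_ofPaths {k : ℕ} {α : Fin k → List G.E} (h : G.IsDisjointPaths u v α) :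
    k ≤ (ofPaths h).ends.ncard := by
  have := G.finiteE
  have hlast : ∀ i, ∃ e, (α i).getLast? = some e := fun i => by
    obtain ⟨e, he, -⟩ := (h.1 i).2.2
    exact ⟨e, he⟩
  choose g hg using hlast
  have hmem : ∀ i, g i ∈ α i := fun i => List.mem_of_getLast? (hg i)
  have hginj : Function.Injective g := fun i j hij =>
    h.index_unique (hmem i) (hij ▸ hmem j)
  have hsub : Set.range g ⊆ (ofPaths h).ends := by
    rintro _ ⟨i, rfl⟩
    refine ⟨⟨i, hmem i⟩, ?_⟩
    rintro f ⟨j, hj⟩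
    obtain rfl := h.index_unique (hmem i) (left_mem_of_pair_infix hj)
    obtain ⟨n, hn, hn'⟩ := pair_infix_iff.mp hj
    have hlt := (List.getElem?_eq_some_iff.mp hn).1
    have hlt' := (List.getElem?_eq_some_iff.mp hn').1
    have hgi := hg i
    rw [List.getLast?_eq_getElem?] at hgi
    have := (List.getElem?_inj hlt (h.1 i).nodup).mp (hn.trans hgi.symm)
    omega
  have := Set.ncard_le_ncard hsub (Set.toFinite _)
  rwa [← Set.image_univ, Set.ncard_image_of_injective _ hginj, Set.ncard_univ, Nat.card_fin] at this

theorem exists_disjointPaths (A : Linkage G u v) :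
    ∃ α : Fin A.ends.ncard → List G.E, G.IsDisjointPaths u v α ∧
      ∀ i e f, [e, f] <:+: α i → A.next e f := by
  have := G.finiteE
  obtain ⟨r, -, hr⟩ := G.exists_topological_numbering
  obtain ⟨t, -, -, heq, hself⟩ := exists_terminal_map (N := A.next) A.adj A.right_unique
  have key : ∀ j ∈ A.ends, ∃ l : List G.E, G.IsPath u v l ∧ (∀ e ∈ l, t e = j) ∧
      ∀ e f, [e, f] <:+: l → A.next e f := by
    intro j hj
    obtain ⟨i, hi, hmin⟩ := (Set.toFinite {i | Relation.ReflTransGen A.next i j}).exists_minimalFor r _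
      ⟨j, Relation.ReflTransGen.refl⟩
    have hinit : ∀ e, ¬ A.next e i := fun e he => by
      have h1 := hr _ _ (A.adj he)
      have h2 := hmin (Relation.ReflTransGen.head he hi) h1.le
      omega
    have hiA : i ∈ A.carrier := by
      rcases Relation.ReflTransGen.cases_head hi with h | ⟨f, h, -⟩
      · exact h ▸ hj.1
      · exact A.left_mem h
    obtain ⟨l, hl, hlast⟩ := List.exists_isChain_cons_of_relationReflTransGen hi
    have hlast' : (i :: l).getLast? = some j := by
      rw [List.getLast?_eq_getLast_of_ne_nil (List.cons_ne_nil i l), hlast]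
    refine ⟨i :: l, ⟨hl.imp fun e f h => A.adj h, ⟨i, rfl, A.src_eq hiA hinit⟩,
      ⟨j, hlast', A.tgt_eq hj.1 hj.2⟩⟩, ?_, ?_⟩
    · intro e he
      have htj : t j = j := hself j hj.2
      rw [← htj]
      exact hl.backwards_cons_induction (fun x => t x = t j) l hlast
        (fun x y hxy h => (heq x y hxy).trans h) rfl e he
    · intro e f hef
      simpa using hl.infix hef
  choose! P hP1 hP2 hP3 using key
  let ι := Finite.equivFin A.ends
  have hcard : A.ends.ncard = Nat.card A.ends := rfl
  refine ⟨fun i => P (ι.symm (Fin.cast hcard i)), ⟨fun i => hP1 _ (Subtype.coe_prop _), ?_⟩,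
    fun i e f => hP3 _ (Subtype.coe_prop _) e f⟩
  intro i j hij e he he'
  have h1 := hP2 _ (Subtype.coe_prop _) e he
  have h2 := hP2 _ (Subtype.coe_prop _) e he'
  have h3 := ι.symm.injective (Subtype.ext (h1.symm.trans h2))
  exact hij (Fin.cast_injective hcard h3)

theorem arcs_comm (A : Linkage G u v) (B : Linkage G u' v') : A.arcs B = B.arcs A := by
  ext a
  exact or_comm

/-- Two linkages can be replaced by ones with the same last edges that admit no residual cycle: repeat
rerouting while the number of pairs in `arcs` decreases. -/
theorem exists_wellFounded_residual (A₀ : Linkage G u v) (B₀ : Linkage G u' v') :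
    ∃ (A : Linkage G u v) (B : Linkage G u' v'), A.ends = A₀.ends ∧ B.ends = B₀.ends ∧
      WellFounded (flip (A.Residual B)) ∧ WellFounded (flip (B.Residual A)) := by
  have := G.finiteE
  induction hn : (A₀.arcs B₀).ncard using Nat.strong_induction_on generalizing A₀ B₀ with
  | _ n ih =>
    subst hn
    by_cases hA : WellFounded (flip (A₀.Residual B₀))
    · by_cases hB : WellFounded (flip (B₀.Residual A₀))
      · exact ⟨A₀, B₀, rfl, rfl, hA, hB⟩
      · obtain ⟨B₁, hends, hlt⟩ := B₀.exists_arcs_ssubset_of_not_wellFounded A₀ hB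
        rw [arcs_comm B₁, arcs_comm B₀] at hlt
        obtain ⟨A, B, h1, h2, h3⟩ := ih _ (Set.ncard_lt_ncard hlt (Set.toFinite _)) A₀ B₁ rfl
        exact ⟨A, B, h1, h2.trans hends, h3⟩
    · obtain ⟨A₁, hends, hlt⟩ := A₀.exists_arcs_ssubset_of_not_wellFounded B₀ hA
      obtain ⟨A, B, h1, h2, h3⟩ := ih _ (Set.ncard_lt_ncard hlt (Set.toFinite _)) A₁ B₀ rfl
      exact ⟨A, B, h1.trans hends, h2, h3⟩

end Linkage

theorem IsDisjointPaths.le_minCut {u v : G.V} {k : ℕ} {α : Fin k → List G.E}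
    (h : G.IsDisjointPaths u v α) : k ≤ G.minCut u v := by
  have hne : {k : ℕ | ∃ C : Finset G.E, G.IsCut u v C ∧ C.card = k}.Nonempty := by
    obtain ⟨C, hC⟩ := G.exists_isCut u v
    exact ⟨_, C, hC, rfl⟩
  obtain ⟨C, hC, hcard⟩ := Nat.sInf_mem hne
  have hex : ∀ i, ∃ e ∈ α i, e ∈ C := fun i => hC _ (h.1 i)
  choose g hg hgC using hex
  have hginj : Function.Injective g := fun i j hij => h.index_unique (hg i) (hij ▸ hg j)
  have := Finset.card_le_card_of_injOn (s := Finset.univ) g (fun i _ => hgC i) hginj.injOn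
  rw [Finset.card_univ, Fintype.card_fin, hcard] at this
  exact this

theorem exists_isMengerPaths (G : AcyclicNetwork) (u v : G.V) :
    ∃ k, ∃ α : Fin k → List G.E, G.IsMengerPaths u v α := by
  classical
  let P : ℕ → Prop := fun k => ∃ α : Fin k → List G.E, G.IsDisjointPaths u v α
  have h0 : P 0 := ⟨Fin.elim0, fun i => i.elim0, fun i => i.elim0⟩
  obtain ⟨α, hα⟩ := Nat.findGreatest_spec (P := P) (Nat.zero_le (G.minCut u v)) h0
  exact ⟨_, α, hα, fun l β hβ => Nat.le_findGreatest hβ.le_minCut ⟨β, hβ⟩⟩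

theorem minMergings_le_thirteen (G : AcyclicNetwork) (h₁ : G.minCut G.S₁ G.R₁ ≤ 3)
    (h₂ : G.minCut G.S₂ G.R₂ ≤ 3) : G.minMergings ≤ 13 := by
  obtain ⟨k₁, α, hα, hmaxα⟩ := G.exists_isMengerPaths G.S₁ G.R₁
  obtain ⟨k₂, β, hβ, hmaxβ⟩ := G.exists_isMengerPaths G.S₂ G.R₂
  obtain ⟨A, B, hA, hB, hAB, hBA⟩ :=
    Linkage.exists_wellFounded_residual (Linkage.ofPaths hα) (Linkage.ofPaths hβ)
  obtain ⟨φ, hφ, hφA⟩ := A.exists_disjointPaths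
  obtain ⟨ψ, hψ, hψB⟩ := B.exists_disjointPaths
  have hk₁ := Linkage.le_ncard_ends_ofPaths hα
  have hk₂ := Linkage.le_ncard_ends_ofPaths hβ
  rw [← hA] at hk₁
  rw [← hB] at hk₂
  have hφ' : G.IsMengerPaths G.S₁ G.R₁ φ := ⟨hφ, fun l γ hγ => (hmaxα l γ hγ).trans hk₁⟩
  have hψ' : G.IsMengerPaths G.S₂ G.R₂ ψ := ⟨hψ, fun l γ hγ => (hmaxβ l γ hγ).trans hk₂⟩
  have hle : mergings φ ψ ≤ 13 := by
    refine (Set.encard_le_encard ?_).trans (A.encard_sharedStarts_le B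
      (hφ.le_minCut.trans h₁) (hψ.le_minCut.trans h₂) hAB hBA)
    rintro e ⟨i, j, f, g, hfg, hf, hg⟩
    have h1 := hφA i f e hf
    have h2 := hψB j g e hg
    exact ⟨A.right_mem h1, B.right_mem h2, fun f' h3 h4 =>
      hfg ((A.left_unique h1 h3).trans (B.left_unique h4 h2))⟩
  refine le_trans ?_ hle
  unfold minMergings
  exact iInf_le_of_le A.ends.ncard <| iInf_le_of_le B.ends.ncard <| iInf_le_of_le φ <|
    iInf_le_of_le ψ <| iInf_le_of_le hφ' <| iInf_le _ hψ'

end AcyclicNetwork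

/-! ### A network with thirteen unavoidable mergings -/

namespace AcyclicNetwork

section potential

variable {G : AcyclicNetwork} {u v : G.V}

theorem IsPath.sum_potential {p : List G.E} (h : G.IsPath u v p) (w : G.V → ℤ) :
    (p.map fun e => w (G.tgt e) - w (G.src e)).sum = w v - w u := by
  induction p generalizing u with
  | nil => obtain ⟨-, ⟨e, he, -⟩, -⟩ := h; simp at he
  | cons e p ih =>
    obtain ⟨hc, ⟨e', he', hu⟩, ⟨f, hf, hv⟩⟩ := h
    obtain rfl : e = e' := by simpa using he'
    cases p with
    | nil =>
      obtain rfl : e = f := by simpa using hf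
      simp [hu, hv]
    | cons e₁ p =>
      rw [List.isChain_cons_cons] at hc
      have h' : G.IsPath (G.src e₁) v (e₁ :: p) :=
        ⟨hc.2, ⟨e₁, rfl, rfl⟩, ⟨f, by simpa using hf, hv⟩⟩
      rw [List.map_cons, List.sum_cons, ih h', hc.1, hu]
      ring

/-- Let `F` be exactly the set of edges along which `w` increases, with total increase that of `k` paths
from `u` to `v`. Then any `k` or more disjoint paths use all edges of `F` and no others: the sum of
the increments over a set of edges is largest for `F` and for no other set. -/
theorem IsDisjointPaths.mem_iff_of_potential {k l : ℕ} {α : Fin l → List G.E}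
    (h : G.IsDisjointPaths u v α) (hkl : k ≤ l) (F : Finset G.E) (w : G.V → ℤ) (huv : w u ≤ w v)
    (hF : ∀ e ∈ F, w (G.src e) < w (G.tgt e)) (hF' : ∀ e ∉ F, w (G.tgt e) < w (G.src e))
    (hsum : ∑ e ∈ F, (w (G.tgt e) - w (G.src e)) = k * (w v - w u)) (e : G.E) :
    e ∈ F ↔ ∃ i, e ∈ α i := by
  classical
  let c : G.E → ℤ := fun e => w (G.tgt e) - w (G.src e)
  let U : Finset G.E := Finset.univ.biUnion fun i => (α i).toFinset
  have hU : ∑ e ∈ U, c e = l * (w v - w u) := by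
    rw [Finset.sum_biUnion]
    · have : ∀ i ∈ Finset.univ, ∑ e ∈ (α i).toFinset, c e = w v - w u := fun i _ => by
        rw [List.sum_toFinset _ (h.1 i).nodup]
        exact (h.1 i).sum_potential w
      rw [Finset.sum_congr rfl this, Finset.sum_const, Finset.card_univ, Fintype.card_fin,
        nsmul_eq_mul]
    · intro i _ j _ hij
      exact List.disjoint_toFinset_iff_disjoint.mpr (h.2 hij)
  have h1 : ∑ e ∈ F, c e ≤ ∑ e ∈ U, c e := by
    rw [hU]
    refine hsum.le.trans (mul_le_mul_of_nonneg_right (by exact_mod_cast hkl) (by linarith))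
  have h2 := Finset.sum_sdiff_sub_sum_sdiff (s₁ := F) (s₂ := U) (f := c)
  have h3 : ∀ e ∈ F \ U, 0 < c e := fun e he => by
    have := hF e (Finset.mem_sdiff.mp he).1
    simp only [c]; linarith
  have h4 : ∀ e ∈ U \ F, c e < 0 := fun e he => by
    have := hF' e (Finset.mem_sdiff.mp he).2
    simp only [c]; linarith
  have h5 : F \ U = ∅ := by
    by_contra hne
    have := Finset.sum_pos h3 (Finset.nonempty_iff_ne_empty.mpr hne)
    have := Finset.sum_nonpos fun e he => (h4 e he).le
    linarith
  have h6 : U \ F = ∅ := by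
    by_contra hne
    have := Finset.sum_neg h4 (Finset.nonempty_iff_ne_empty.mpr hne)
    have := Finset.sum_nonneg fun e he => (h3 e he).le
    linarith
  have hFU : F = U :=
    Finset.Subset.antisymm (Finset.sdiff_eq_empty_iff_subset.mp h5)
      (Finset.sdiff_eq_empty_iff_subset.mp h6)
  rw [hFU]
  simp [U]

theorem minCut_le_card_src [DecidableEq G.V] [Fintype G.E] (u v : G.V) :
    G.minCut u v ≤ (Finset.univ.filter fun e => G.src e = u).card := by
  refine Nat.sInf_le ⟨_, fun p hp => ?_, rfl⟩
  obtain ⟨-, ⟨e, he, hu⟩, -⟩ := hp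
  exact ⟨e, List.mem_of_head? he, by simp [hu]⟩

end potential

end AcyclicNetwork

/-- If every edge leads upward in some order of the vertices, there are no closed chains of edges. -/
theorem List.IsChain.head_lt_getLast {V E : Type} [Preorder V] {s t : E → V}
    (h : ∀ e, s e < t e) {p : List E} (hp : p.IsChain fun e f => t e = s f) :
    ∀ e ∈ p.head?, ∀ f ∈ p.getLast?, s e < t f := by
  induction p with
  | nil => simp
  | cons a p ih =>
    intro e he f hf
    obtain rfl : a = e := by simpa using he
    cases p with
    | nil =>
      obtain rfl : a = f := by simpa using hf
      exact h a
    | cons b p =>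
      rw [List.isChain_cons_cons] at hp
      exact ((h a).trans_eq hp.1).trans (ih hp.2 b rfl f (by simpa using hf))

namespace ThirteenMergings

/-- The first vertices of the edges of the network below. Vertices `0`, `1` are the sources and `28`,
`29` the sinks. Edge `t < 13`, from vertex `2 + 2 * t` to `3 + 2 * t`, is shared by the two families,
edges `13` to `28` belong to the first family only and the rest to the second only. The shared edges
correspond, in order, to the run `(0,0), (0,1), (0,2), (1,2), (2,2), (2,0), (2,1), (0,1), (1,1),
(1,2), (1,0), (0,0), (2,0)` of the machine. -/
def src : Fin 45 → Fin 30 :=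
  ![2, 4, 6, 8, 10, 12, 14, 16, 18, 20, 22, 24, 26,
    0, 3, 5, 7, 17, 25, 0, 9, 19, 21, 23, 0, 11, 13, 15, 27,
    1, 3, 13, 23, 25, 27, 1, 5, 15, 17, 19, 1, 7, 9, 11, 21]

/-- The last vertices of the edges. -/
def tgt : Fin 45 → Fin 30 :=
  ![3, 5, 7, 9, 11, 13, 15, 17, 19, 21, 23, 25, 27,
    2, 4, 6, 16, 24, 28, 8, 18, 20, 22, 28, 10, 12, 14, 26, 28,
    2, 12, 22, 24, 26, 29, 4, 14, 16, 18, 29, 6, 8, 10, 20, 29]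

theorem src_lt_tgt : ∀ e, src e < tgt e := by decide +kernel

/-- A network in which all Menger's paths merge at thirteen edges. -/
@[reducible] def network : AcyclicNetwork where
  V := Fin 30
  E := Fin 45
  finiteV := inferInstance
  finiteE := inferInstance
  src := src
  tgt := tgt
  acyclic p hp e he f hf := (List.IsChain.head_lt_getLast src_lt_tgt hp e he f hf).ne'
  S₁ := 0
  S₂ := 1
  R₁ := 28
  R₂ := 29
  sources_ne := by decide
  sinks_ne := by decide

/-- The first family of paths. -/
def φ : Fin 3 → List (Fin 45) :=
  ![[13, 0, 14, 1, 15, 2, 16, 7, 17, 11, 18], [19, 3, 20, 8, 21, 9, 22, 10, 23],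
    [24, 4, 25, 5, 26, 6, 27, 12, 28]]

/-- The second family of paths. -/
def ψ : Fin 3 → List (Fin 45) :=
  ![[29, 0, 30, 5, 31, 10, 32, 11, 33, 12, 34], [35, 1, 36, 6, 37, 7, 38, 8, 39],
    [40, 2, 41, 3, 42, 4, 43, 9, 44]]

theorem isDisjointPaths_φ : network.IsDisjointPaths 0 28 φ := by
  constructor
  · intro i
    fin_cases i <;> exact ⟨by decide, ⟨_, rfl, rfl⟩, ⟨_, rfl, rfl⟩⟩
  · change ∀ i j : Fin 3, i ≠ j → ∀ a ∈ φ i, a ∈ φ j → False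
    decide +kernel

theorem isDisjointPaths_ψ : network.IsDisjointPaths 1 29 ψ := by
  constructor
  · intro i
    fin_cases i <;> exact ⟨by decide, ⟨_, rfl, rfl⟩, ⟨_, rfl, rfl⟩⟩
  · change ∀ i j : Fin 3, i ≠ j → ∀ a ∈ ψ i, a ∈ ψ j → False
    decide +kernel

/-- The edges of `φ`. -/
def edgesφ : Finset (Fin 45) := Finset.univ.filter fun e => e.val < 29

/-- The edges of `ψ`. -/
def edgesψ : Finset (Fin 45) := Finset.univ.filter fun e => e.val < 13 ∨ 29 ≤ e.val

/-- A vertex potential that increases along the edges of `φ` and decreases along all others. -/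
def potentialφ : Fin 30 → ℤ :=
  ![0, 12, 1, 8, 9, 10, 11, 12, 1, 2, 1, 6, 7, 8, 9, 14, 13, 14, 3, 4, 5, 6, 7, 16, 15, 16, 15,
    16, 17, 0]

/-- A vertex potential that increases along the edges of `ψ` and decreases along all others. -/
def potentialψ : Fin 30 → ℤ :=
  ![16, 0, 1, 2, 1, 2, 1, 12, 13, 14, 15, 16, 3, 4, 3, 10, 11, 12, 13, 18, 17, 18, 5, 6, 7, 8, 9,
    10, 0, 19]

theorem mem_edgesφ_iff {l : ℕ} {α : Fin l → List (Fin 45)} (h : network.IsDisjointPaths 0 28 α)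
    (hl : 3 ≤ l) (e : Fin 45) : e ∈ edgesφ ↔ ∃ i, e ∈ α i :=
  h.mem_iff_of_potential hl edgesφ potentialφ (by decide +kernel) (by decide +kernel)
    (by decide +kernel) (by decide +kernel) e

theorem mem_edgesψ_iff {l : ℕ} {α : Fin l → List (Fin 45)} (h : network.IsDisjointPaths 1 29 α)
    (hl : 3 ≤ l) (e : Fin 45) : e ∈ edgesψ ↔ ∃ i, e ∈ α i :=
  h.mem_iff_of_potential hl edgesψ potentialψ (by decide +kernel) (by decide +kernel)
    (by decide +kernel) (by decide +kernel) e

/-- The shared edges do not start at a source, and the edges leading to them differ in the two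
families. -/
theorem preceding_ne : ∀ e : Fin 45, e.val < 13 → src e ≠ 0 ∧ src e ≠ 1 ∧
    ∀ f ∈ edgesφ, f ∈ edgesψ → tgt f ≠ src e := by
  decide +kernel

theorem thirteen_le_minMergings : 13 ≤ network.minMergings := by
  refine le_iInf fun k => le_iInf fun l => le_iInf fun α => le_iInf fun β => le_iInf fun hα =>
    le_iInf fun hβ => ?_
  have hα' := mem_edgesφ_iff hα.1 (hα.2 3 φ isDisjointPaths_φ)
  have hβ' := mem_edgesψ_iff hβ.1 (hβ.2 3 ψ isDisjointPaths_ψ)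
  have hmem : ((Finset.univ.filter fun e : Fin 45 => e.val < 13 : Finset (Fin 45)) : Set (Fin 45)) ⊆
      {e | ∃ i j, AcyclicNetwork.MergeAt (G := network) (α i) (β j) e} := by
    intro e he
    have he13 : e.val < 13 := by simpa using he
    obtain ⟨h0, h1, hne⟩ := preceding_ne e he13
    obtain ⟨i, hi⟩ := (hα' e).mp (by simp [edgesφ]; omega)
    obtain ⟨j, hj⟩ := (hβ' e).mp (by simp [edgesψ]; omega)
    obtain ⟨f, hf⟩ : ∃ f, [f, e] <:+: α i := by
      by_contra hno
      push Not at hno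
      exact h0 ((hα.1.1 i).src_eq hi hno)
    obtain ⟨g, hg⟩ : ∃ g, [g, e] <:+: β j := by
      by_contra hno
      push Not at hno
      exact h1 ((hβ.1.1 j).src_eq hj hno)
    refine ⟨i, j, f, g, ?_, hf, hg⟩
    rintro rfl
    exact hne f ((hα' f).mpr ⟨i, AcyclicNetwork.left_mem_of_pair_infix hf⟩)
      ((hβ' f).mpr ⟨j, AcyclicNetwork.left_mem_of_pair_infix hg⟩) ((hα.1.1 i).adj hf)
  refine le_trans ?_ (Set.encard_le_encard hmem)
  rw [Set.encard_coe_eq_coe_finsetCard]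
  exact le_of_eq (by decide +kernel)

theorem minCut_φ : network.minCut 0 28 = 3 :=
  le_antisymm ((AcyclicNetwork.minCut_le_card_src (G := network) 0 28).trans (by decide +kernel))
    isDisjointPaths_φ.le_minCut

theorem minCut_ψ : network.minCut 1 29 = 3 :=
  le_antisymm ((AcyclicNetwork.minCut_le_card_src (G := network) 1 29).trans (by decide +kernel))
    isDisjointPaths_ψ.le_minCut

end ThirteenMergings

theorem theoremm33 : maxMinMergings 3 3 = 13 := by
  refine le_antisymm (iSup_le fun G => iSup_le fun h₁ => iSup_le fun h₂ =>
    G.minMergings_le_thirteen h₁.le h₂.le) ?_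
  exact ThirteenMergings.thirteen_le_minMergings.trans <|
    le_iSup_of_le ThirteenMergings.network <| le_iSup_of_le ThirteenMergings.minCut_φ <|
    le_iSup_of_le ThirteenMergings.minCut_ψ le_rfl
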